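/- Let $(M,g)$ be a spacetime, i.e. a smooth (Hausdorff, second countable, finite-dimensional) manifold $M$ without boundary, with a smooth Lorentzian metric $g$ of signature $(-,+,\dots,+)$ and a time-orientation, given by a continuous timelike vector field declared future-directed. A nonzero tangent vector $v$ is called timelike if $g(v,v)<0$, null if $g(v,v)=0$, and causal if it is timelike or null. A causal vector is future-directed (past-directed) if it lies in the same causal cone as the time-orienting field (in the opposite one). A smooth function $f\colon M\to\mathbb{R}$ is called a quasi-time function if (i) its gradient $\nabla f$, defined by $g(\nabla f,\cdot)=df$, is everywhere nonzero, causal and past-directed, and (ii) every null geodesic segment $\gamma\colon[a,b]\to M$, $a<b$ (a geodesic of the Levi-Civita connection whose velocity is everywhere null, in particular nonzero), such that $f\circ\gamma$ is constant, is injective. Then: if $(M,g)$ admits a quasi-time function, $(M,g)$ is causal, i.e. it contains no closed causal curve: there is no piecewise $C^1$ curve $\gamma\colon[a,b]\to M$, $a<b$, with $\gamma(a)=\gamma(b)$ whose velocity (one-sided at break points and end points) is everywhere causal and future-directed. -/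

import Mathlib

open Set
open scoped Manifold ContDiff Bundle

namespace QuasiTime

section Definitions

variable {E : Type*} [NormedAddCommGroup E] [NormedSpace ℝ E]
  {M : Type*} [TopologicalSpace M] [ChartedSpace E M] [IsManifold 𝓘(ℝ, E) ∞ M]

/-- A smooth Lorentzian metric of signature `(-,+,…,+)` on a smooth manifold `M` modelled on `E`:
a smooth field of symmetric bilinear forms on the tangent spaces such that each of them is negative
on some vector `v` and positive definite on the orthogonal complement of `v`. -/
structure LorentzMetric (E : Type*) [NormedAddCommGroup E] [NormedSpace ℝ E]
    (M : Type*) [TopologicalSpace M] [ChartedSpace E M] [IsManifold 𝓘(ℝ, E) ∞ M] where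
  /-- The bilinear form on each tangent space. -/
  inner (x : M) : TangentSpace 𝓘(ℝ, E) x →L[ℝ] TangentSpace 𝓘(ℝ, E) x →L[ℝ] ℝ
  symm (x : M) (v w : TangentSpace 𝓘(ℝ, E) x) : inner x v w = inner x w v
  signature (x : M) : ∃ v : TangentSpace 𝓘(ℝ, E) x, inner x v v < 0 ∧
    ∀ w : TangentSpace 𝓘(ℝ, E) x, inner x v w = 0 → w ≠ 0 → 0 < inner x w w
  contMDiff : ContMDiff 𝓘(ℝ, E) (𝓘(ℝ, E).prod 𝓘(ℝ, E →L[ℝ] E →L[ℝ] ℝ)) ∞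
    (fun x : M ↦ Bundle.TotalSpace.mk' (E →L[ℝ] E →L[ℝ] ℝ)
      (E := fun x : M ↦ TangentSpace 𝓘(ℝ, E) x →L[ℝ] TangentSpace 𝓘(ℝ, E) x →L[ℝ] ℝ)
      x (inner x))

variable (g : LorentzMetric E M)

/-- A tangent vector is timelike if `g(v,v) < 0`. -/
def IsTimelike {x : M} (v : TangentSpace 𝓘(ℝ, E) x) : Prop :=
  g.inner x v v < 0

/-- A tangent vector is null (lightlike) if it is nonzero and `g(v,v) = 0`. -/
def IsNull {x : M} (v : TangentSpace 𝓘(ℝ, E) x) : Prop :=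
  v ≠ 0 ∧ g.inner x v v = 0

/-- A tangent vector is causal if it is timelike or null. -/
def IsCausalVector {x : M} (v : TangentSpace 𝓘(ℝ, E) x) : Prop :=
  IsTimelike g v ∨ IsNull g v

/-- A time-orientation, given by a continuous timelike vector field (declared future-directed). -/
structure TimeOrientation where
  /-- The timelike vector field that singles out the future cones. -/
  field (x : M) : TangentSpace 𝓘(ℝ, E) x
  continuous_field : Continuous (fun x ↦ (⟨x, field x⟩ : TangentBundle 𝓘(ℝ, E) M))
  timelike (x : M) : IsTimelike g (field x)

variable {g}

/-- A causal vector is future-directed if it lies in the same causal cone as the time-orientation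
field `T`; in signature `(-,+,…,+)` this means `g(T,v) < 0`. -/
def TimeOrientation.FutureCausal (T : TimeOrientation g) {x : M}
    (v : TangentSpace 𝓘(ℝ, E) x) : Prop :=
  IsCausalVector g v ∧ g.inner x (T.field x) v < 0

/-- A causal vector is past-directed if it lies in the causal cone opposite to that of the
time-orientation field `T`. -/
def TimeOrientation.PastCausal (T : TimeOrientation g) {x : M}
    (v : TangentSpace 𝓘(ℝ, E) x) : Prop :=
  IsCausalVector g v ∧ 0 < g.inner x (T.field x) v

/-- The velocity `γ'(t)` of a curve relative to a set `s` of parameters (one-sided at the end points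
if `s` is a closed interval). -/
noncomputable def velocity (γ : ℝ → M) (s : Set ℝ) (t : ℝ) : TangentSpace 𝓘(ℝ, E) (γ t) :=
  mfderivWithin 𝓘(ℝ, ℝ) 𝓘(ℝ, E) γ s t (1 : ℝ)

/-- `γ : [a,b] → M` is a future-directed piecewise `C¹` causal curve: there is a partition
`a = t₀ < t₁ < … < tₙ = b` such that on every closed piece `[tᵢ, tᵢ₊₁]` the curve is `C¹` and its
velocity is everywhere (one-sidedly at the end points) a future-directed causal vector. -/
def IsFutureCausalCurve (T : TimeOrientation g) (γ : ℝ → M) (a b : ℝ) : Prop :=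
  ∃ (n : ℕ) (t : ℕ → ℝ), t 0 = a ∧ t n = b ∧ ∀ i < n, t i < t (i + 1) ∧
    ContMDiffOn 𝓘(ℝ, ℝ) 𝓘(ℝ, E) 1 γ (Icc (t i) (t (i + 1))) ∧
    ∀ r ∈ Icc (t i) (t (i + 1)), T.FutureCausal (velocity γ (Icc (t i) (t (i + 1))) r)

/-- A time-oriented Lorentzian manifold is causal if it contains no closed causal curve. -/
def IsCausal (T : TimeOrientation g) : Prop :=
  ¬ ∃ (γ : ℝ → M) (a b : ℝ), a < b ∧ IsFutureCausalCurve T γ a b ∧ γ a = γ b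

/-! ### Gradient -/

/-- Nondegeneracy of a Lorentzian metric. -/
theorem LorentzMetric.nondegenerate (g : LorentzMetric E M) (x : M)
    (v : TangentSpace 𝓘(ℝ, E) x) (h : ∀ w, g.inner x v w = 0) : v = 0 := by
  obtain ⟨u, -, hu⟩ := g.signature x
  by_contra hv
  exact (hu v (by rw [g.symm, h]) hv).ne' (h v)

/-- The Riesz representation of covectors by a Lorentzian metric. -/
theorem LorentzMetric.exists_unique_dual [FiniteDimensional ℝ E] (g : LorentzMetric E M) (x : M)
    (φ : TangentSpace 𝓘(ℝ, E) x →L[ℝ] ℝ) :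
    ∃! v : TangentSpace 𝓘(ℝ, E) x, ∀ w, g.inner x v w = φ w := by
  have : FiniteDimensional ℝ (TangentSpace 𝓘(ℝ, E) x) := inferInstanceAs (FiniteDimensional ℝ E)
  let L : TangentSpace 𝓘(ℝ, E) x →ₗ[ℝ] Module.Dual ℝ (TangentSpace 𝓘(ℝ, E) x) :=
    { toFun := fun v ↦ (g.inner x v).toLinearMap
      map_add' := fun v w ↦ by ext; simp
      map_smul' := fun c v ↦ by ext; simp }
  have hinj : Function.Injective L := by
    rw [injective_iff_map_eq_zero]
    intro v hv
    exact g.nondegenerate x v fun w ↦ LinearMap.congr_fun hv w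
  have hsurj : Function.Surjective L :=
    (LinearMap.injective_iff_surjective_of_finrank_eq_finrank
      (Subspace.dual_finrank_eq (K := ℝ)).symm).1 hinj
  obtain ⟨v, hv⟩ := hsurj φ.toLinearMap
  refine ⟨v, fun w ↦ LinearMap.congr_fun hv w, fun v' hv' ↦ hinj ?_⟩
  rw [hv]
  exact LinearMap.ext hv'

/-- The gradient `∇f` of a function: the unique vector field with `g(∇f, w) = df(w)`. -/
noncomputable def gradient [FiniteDimensional ℝ E] (g : LorentzMetric E M) (f : M → ℝ) (x : M) :
    TangentSpace 𝓘(ℝ, E) x :=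
  (g.exists_unique_dual x (mfderiv 𝓘(ℝ, E) 𝓘(ℝ, ℝ) f x)).choose

theorem inner_gradient [FiniteDimensional ℝ E] (g : LorentzMetric E M) (f : M → ℝ) (x : M)
    (w : TangentSpace 𝓘(ℝ, E) x) :
    g.inner x (gradient g f x) w = (mfderiv 𝓘(ℝ, E) 𝓘(ℝ, ℝ) f x w : ℝ) :=
  (g.exists_unique_dual x (mfderiv 𝓘(ℝ, E) 𝓘(ℝ, ℝ) f x)).choose_spec.1 w

/-! ### Geodesics -/

/-- The metric in the coordinates of a chart `e`, i.e. the pull-back of `g` by the inverse chart: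
at `x ∈ e.target` this is the bilinear form `(u, v) ↦ g(De⁻¹ u, De⁻¹ v)` on the model space. -/
noncomputable def metricInChart (g : LorentzMetric E M) (e : OpenPartialHomeomorph M E) (x : E) :
    E →L[ℝ] E →L[ℝ] ℝ :=
  let B : E →L[ℝ] E →L[ℝ] ℝ := g.inner (e.symm x)
  let D : E →L[ℝ] E := mfderiv 𝓘(ℝ, E) 𝓘(ℝ, E) e.symm x
  B.bilinearComp D D

/-- The Christoffel symbols of the first kind of the Levi-Civita connection in a chart, as a
trilinear form: `Γ(u,v;w) = ½ (∂_u g(v,w) + ∂_v g(u,w) - ∂_w g(u,v))`. -/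
noncomputable def christoffel (g : LorentzMetric E M) (e : OpenPartialHomeomorph M E) (x : E)
    (u v w : E) : ℝ :=
  (1 / 2) * (fderiv ℝ (metricInChart g e) x u v w + fderiv ℝ (metricInChart g e) x v u w
    - fderiv ℝ (metricInChart g e) x w u v)

/-- `γ` is a geodesic on the (nondegenerate) interval `s`: it is `C²` there, and in every chart of
the smooth structure its coordinate expression `c = e ∘ γ` satisfies the geodesic equation
`c'' + Γ(c', c') = 0`, written here with the index lowered by the (nondegenerate) metric:
`g(c'', w) + Γ(c', c'; w) = 0` for all `w`. Such curves are automatically smooth. -/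
def IsGeodesicOn (g : LorentzMetric E M) (γ : ℝ → M) (s : Set ℝ) : Prop :=
  ContMDiffOn 𝓘(ℝ, ℝ) 𝓘(ℝ, E) 2 γ s ∧
    ∀ e ∈ IsManifold.maximalAtlas 𝓘(ℝ, E) ∞ M, ∀ t ∈ s, γ t ∈ e.source → ∀ w : E,
      let c : ℝ → E := fun r ↦ e (γ r)
      metricInChart g e (c t) (derivWithin (derivWithin c s) s t) w
        + christoffel g e (c t) (derivWithin c s t) (derivWithin c s t) w = 0

/-- A null geodesic: a geodesic whose velocity is everywhere null (in particular nonzero). -/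
def IsNullGeodesicOn (g : LorentzMetric E M) (γ : ℝ → M) (s : Set ℝ) : Prop :=
  IsGeodesicOn g γ s ∧ ∀ t ∈ s, IsNull g (velocity γ s t)

/-- A quasi-time function: a smooth function `f` such that `∇f` is everywhere nonzero, causal and
past-directed, and such that every null geodesic segment `γ : [a,b] → M` along which `f` is
constant is injective. -/
structure IsQuasiTimeFunction [FiniteDimensional ℝ E] (T : TimeOrientation g) (f : M → ℝ) :
    Prop where
  smooth : ContMDiff 𝓘(ℝ, E) 𝓘(ℝ, ℝ) ∞ f
  gradient_ne_zero (x : M) : gradient g f x ≠ 0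
  gradient_pastCausal (x : M) : T.PastCausal (gradient g f x)
  injOn_of_isNullGeodesicOn (γ : ℝ → M) (a b : ℝ) (hab : a < b)
    (hγ : IsNullGeodesicOn g γ (Icc a b)) (hf : ∃ k : ℝ, ∀ t ∈ Icc a b, f (γ t) = k) :
    InjOn γ (Icc a b)

end Definitions

end QuasiTime

/-!
Put `h = -f`, so that `∇h` is future-directed causal. Along a future-directed causal curve `γ` one
has `(h ∘ γ)' = g(∇h, γ') ≤ 0`, with equality only where `γ'` is a positive multiple of `∇h`. Hence
`h` is constant along a closed causal curve, which can then be reparametrized, corners included,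
as a closed integral curve `σ` of `∇h`. On it `g(∇h, ∇h) = (h ∘ σ)' = 0` is the maximum of
`g(∇h, ∇h)` on `M`, so `∇_{∇h} ∇h = ½ ∇ g(∇h, ∇h)` vanishes along `σ`. Thus `σ` is a null geodesic
in a level set of `f` that returns to its starting point.
-/

namespace QuasiTime

section CausalVectors

variable {E : Type*} [NormedAddCommGroup E] [NormedSpace ℝ E]
  {M : Type*} [TopologicalSpace M] [ChartedSpace E M] [IsManifold 𝓘(ℝ, E) ∞ M]
  {g : LorentzMetric E M} {T : TimeOrientation g} {x : M} {u v w : TangentSpace 𝓘(ℝ, E) x}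

theorem IsTimelike.inner_self_pos (hu : IsTimelike g u) (huw : g.inner x u w = 0) (hw : w ≠ 0) :
    0 < g.inner x w w := by
  obtain ⟨v, -, hpos⟩ := g.signature x
  by_contra! hww
  have huu : g.inner x u u < 0 := hu
  have hwu : g.inner x w u = 0 := by rw [g.symm, huw]
  have hvw : g.inner x v w ≠ 0 := fun h ↦ hww.not_gt (hpos w h hw)
  -- the combination of `u` and `w` orthogonal to `v`
  set z := g.inner x v w • u - g.inner x v u • w
  have hvz : g.inner x v z = 0 := by
    simp only [z, map_sub, map_smul, smul_eq_mul]
    ring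
  have huz : g.inner x u z = g.inner x v w * g.inner x u u := by
    simp only [z, map_sub, map_smul, smul_eq_mul, huw, mul_zero, sub_zero]
  have hz : z ≠ 0 := fun h ↦ mul_ne_zero hvw huu.ne (by rw [← huz, h, map_zero])
  have hzz : g.inner x z z
      = g.inner x v w ^ 2 * g.inner x u u + g.inner x v u ^ 2 * g.inner x w w := by
    simp only [z, map_sub, map_smul, sub_apply, smul_apply, smul_eq_mul, huw, hwu]
    ring
  have h₁ := mul_nonpos_of_nonneg_of_nonpos (sq_nonneg (g.inner x v w)) huu.le
  have h₂ := mul_nonpos_of_nonneg_of_nonpos (sq_nonneg (g.inner x v u)) hww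
  linarith [hpos z hvz hz]

theorem IsCausalVector.inner_self_nonpos (hv : IsCausalVector g v) : g.inner x v v ≤ 0 :=
  hv.elim le_of_lt fun h ↦ h.2.le

theorem IsCausalVector.ne_zero (hv : IsCausalVector g v) : v ≠ 0 := by
  rintro rfl
  exact hv.elim (fun h ↦ by simp [IsTimelike] at h) fun h ↦ h.1 rfl

theorem IsCausalVector.neg (hv : IsCausalVector g v) : IsCausalVector g (-v) := by
  have hneg : g.inner x (-v) (-v) = g.inner x v v := by rw [map_neg, map_neg, neg_apply, neg_neg]
  simpa only [IsCausalVector, IsTimelike, IsNull, hneg, ne_eq, neg_eq_zero] using hv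

theorem TimeOrientation.PastCausal.neg (hv : T.PastCausal v) : T.FutureCausal (-v) :=
  ⟨hv.1.neg, by rw [map_neg]; exact neg_neg_of_pos hv.2⟩

theorem TimeOrientation.FutureCausal.eq_smul_of_inner_nonneg (hu : T.FutureCausal u)
    (hv : T.FutureCausal v) (h : 0 ≤ g.inner x u v) :
    v = (g.inner x (T.field x) v / g.inner x (T.field x) u) • u := by
  set α := g.inner x (T.field x) u
  set β := g.inner x (T.field x) v
  have hα : α < 0 := hu.2
  have horth : g.inner x (T.field x) (α • v - β • u) = 0 := by
    simp only [map_sub, map_smul, smul_eq_mul, α, β]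
    ring
  have hself : g.inner x (α • v - β • u) (α • v - β • u)
      = α ^ 2 * g.inner x v v + β ^ 2 * g.inner x u u - 2 * (α * β) * g.inner x u v := by
    simp only [map_sub, map_smul, sub_apply, smul_apply, smul_eq_mul, g.symm x v u]
    ring
  have hnonpos : g.inner x (α • v - β • u) (α • v - β • u) ≤ 0 := by
    have h₁ := mul_nonpos_of_nonneg_of_nonpos (sq_nonneg α) hv.1.inner_self_nonpos
    have h₂ := mul_nonpos_of_nonneg_of_nonpos (sq_nonneg β) hu.1.inner_self_nonpos
    have h₃ := mul_nonneg (mul_pos_of_neg_of_neg hα hv.2).le h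
    linarith
  have hzero : α • v = β • u := by
    by_contra hne
    exact hnonpos.not_gt ((T.timelike x).inner_self_pos horth (sub_ne_zero.2 hne))
  rw [div_eq_inv_mul, mul_smul, ← hzero, inv_smul_smul₀ hα.ne]

theorem TimeOrientation.FutureCausal.inner_nonpos (hu : T.FutureCausal u)
    (hv : T.FutureCausal v) : g.inner x u v ≤ 0 := by
  by_contra! h
  rw [hu.eq_smul_of_inner_nonneg hv h.le, map_smul, smul_eq_mul] at h
  exact h.not_ge (mul_nonpos_of_nonneg_of_nonpos (div_pos_of_neg_of_neg hv.2 hu.2).le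
    hu.1.inner_self_nonpos)

end CausalVectors

section Charts

variable {E : Type*} [NormedAddCommGroup E] [NormedSpace ℝ E]
  {H : Type*} [TopologicalSpace H] {I : ModelWithCorners ℝ E H}
  {M : Type*} [TopologicalSpace M] [ChartedSpace H M]

theorem mdifferentiable_of_mem_maximalAtlas {n : WithTop ℕ∞} (hn : n ≠ 0)
    {e : OpenPartialHomeomorph M H} (he : e ∈ IsManifold.maximalAtlas I n M) :
    e.MDifferentiable I I :=
  ⟨(contMDiffOn_of_mem_maximalAtlas he).mdifferentiableOn hn,
    (contMDiffOn_symm_of_mem_maximalAtlas he).mdifferentiableOn hn⟩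

theorem mfderiv_symm_mfderiv {e : OpenPartialHomeomorph M H} (he : e.MDifferentiable I I) {y : H}
    (hy : y ∈ e.target) (v : TangentSpace I (e.symm y)) :
    mfderiv I I e.symm y (mfderiv I I e (e.symm y) v) = v := by
  have h := he.symm_comp_deriv (e.map_target hy)
  rw [e.right_inv hy] at h
  exact DFunLike.congr_fun h v

theorem mfderiv_mfderiv_symm {e : OpenPartialHomeomorph M H} (he : e.MDifferentiable I I) {y : H}
    (hy : y ∈ e.target) (v : TangentSpace I y) :
    mfderiv I I e (e.symm y) (mfderiv I I e.symm y v) = v :=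
  DFunLike.congr_fun (he.comp_symm_deriv hy) v

theorem hasDerivWithinAt_of_hasMFDerivWithinAt {c : ℝ → E} {s : Set ℝ} {r : ℝ} {L : ℝ →L[ℝ] E}
    (h : HasMFDerivWithinAt 𝓘(ℝ, ℝ) 𝓘(ℝ, E) c s r L) : HasDerivWithinAt c (L 1) s r :=
  HasFDerivWithinAt.hasDerivWithinAt (hasMFDerivWithinAt_iff_hasFDerivWithinAt.1 h)

end Charts

section MetricInChart

variable {E : Type*} [NormedAddCommGroup E] [NormedSpace ℝ E]
  {M : Type*} [TopologicalSpace M] [ChartedSpace E M] {e : OpenPartialHomeomorph M E}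

theorem contMDiffOn_mfderiv_symm (he : e ∈ IsManifold.maximalAtlas 𝓘(ℝ, E) ∞ M)
    [IsManifold 𝓘(ℝ, E) 1 M] (u : E) :
    ContMDiffOn 𝓘(ℝ, E) 𝓘(ℝ, E).tangent ∞
      (fun y ↦ (⟨e.symm y, mfderiv 𝓘(ℝ, E) 𝓘(ℝ, E) e.symm y u⟩ : TangentBundle 𝓘(ℝ, E) M))
      e.target := by
  have hmap := (contMDiffOn_symm_of_mem_maximalAtlas he).contMDiffOn_tangentMapWithin
    (m := ∞) (by simp) e.open_target.uniqueMDiffOn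
  have hconst : ContMDiffOn 𝓘(ℝ, E) 𝓘(ℝ, E).tangent ∞
      (fun y ↦ (⟨y, u⟩ : TangentBundle 𝓘(ℝ, E) E)) e.target :=
    contMDiffOn_vectorSpace_iff_contDiffOn.2 (contDiffOn_const (c := u))
  refine (hmap.comp hconst fun y hy ↦ hy).congr fun y hy ↦ ?_
  simp only [Function.comp_apply, tangentMapWithin]
  rw [mfderivWithin_of_isOpen e.open_target hy]

variable [IsManifold 𝓘(ℝ, E) ∞ M]

theorem LorentzMetric.contMDiffWithinAt_inner (g : LorentzMetric E M)
    {E' : Type*} [NormedAddCommGroup E'] [NormedSpace ℝ E']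
    {H' : Type*} [TopologicalSpace H'] {I' : ModelWithCorners ℝ E' H'}
    {N : Type*} [TopologicalSpace N] [ChartedSpace H' N] {n : WithTop ℕ∞} (hn : n ≤ ∞) {b : N → M}
    {v w : ∀ y, TangentSpace 𝓘(ℝ, E) (b y)} {s : Set N} {y : N}
    (hv : ContMDiffWithinAt I' 𝓘(ℝ, E).tangent n
      (fun y ↦ (⟨b y, v y⟩ : TangentBundle 𝓘(ℝ, E) M)) s y)
    (hw : ContMDiffWithinAt I' 𝓘(ℝ, E).tangent n
      (fun y ↦ (⟨b y, w y⟩ : TangentBundle 𝓘(ℝ, E) M)) s y) :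
    ContMDiffWithinAt I' 𝓘(ℝ, ℝ) n (fun y ↦ g.inner (b y) (v y) (w y)) s y := by
  have hb : ContMDiffWithinAt I' 𝓘(ℝ, E) n b s y :=
    (Bundle.contMDiffWithinAt_totalSpace.1 hv).1
  have htotal : ContMDiffWithinAt I' (𝓘(ℝ, E).prod 𝓘(ℝ)) n
      (fun y ↦ Bundle.TotalSpace.mk' ℝ (E := Bundle.Trivial M ℝ) (b y)
        (g.inner (b y) (v y) (w y))) s y := by
    apply ContMDiffWithinAt.clm_bundle_apply₂ (F₁ := E) (F₂ := E)
    · exact (g.contMDiff.of_le hn).contMDiffAt.comp_contMDiffWithinAt y hb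
    · exact hv
    · exact hw
  exact (Bundle.contMDiffWithinAt_totalSpace.1 htotal).2

theorem metricInChart_apply (g : LorentzMetric E M) (e : OpenPartialHomeomorph M E) (y u v : E) :
    metricInChart g e y u v = g.inner (e.symm y)
      (mfderiv 𝓘(ℝ, E) 𝓘(ℝ, E) e.symm y u) (mfderiv 𝓘(ℝ, E) 𝓘(ℝ, E) e.symm y v) := rfl

theorem metricInChart_symm (g : LorentzMetric E M) (e : OpenPartialHomeomorph M E) (y u v : E) :
    metricInChart g e y u v = metricInChart g e y v u := by
  rw [metricInChart_apply, metricInChart_apply, g.symm]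

theorem metricInChart_nondegenerate (g : LorentzMetric E M)
    (he : e.MDifferentiable 𝓘(ℝ, E) 𝓘(ℝ, E)) {y : E} (hy : y ∈ e.target) {u : E}
    (h : ∀ w, metricInChart g e y u w = 0) : u = 0 := by
  have hzero : mfderiv 𝓘(ℝ, E) 𝓘(ℝ, E) e.symm y u = 0 := by
    refine g.nondegenerate _ _ fun w ↦ ?_
    rw [← mfderiv_symm_mfderiv he hy w]
    exact h (mfderiv 𝓘(ℝ, E) 𝓘(ℝ, E) e (e.symm y) w)
  have hu := mfderiv_mfderiv_symm he hy u
  rw [hzero, map_zero] at hu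
  exact hu.symm

theorem contDiffOn_metricInChart [FiniteDimensional ℝ E] (g : LorentzMetric E M)
    (he : e ∈ IsManifold.maximalAtlas 𝓘(ℝ, E) ∞ M) :
    ContDiffOn ℝ ∞ (metricInChart g e) e.target := by
  refine contDiffOn_clm_apply.2 fun u ↦ contDiffOn_clm_apply.2 fun v y hy ↦ ?_
  have hsmooth := g.contMDiffWithinAt_inner (I' := 𝓘(ℝ, E)) le_rfl
    (contMDiffOn_mfderiv_symm he u y hy) (contMDiffOn_mfderiv_symm he v y hy)
  exact contMDiffWithinAt_iff_contDiffWithinAt.1 hsmooth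

theorem isInvertible_of_nondegenerate [FiniteDimensional ℝ E] {B : E →L[ℝ] E →L[ℝ] ℝ}
    (hB : ∀ u, (∀ w, B u w = 0) → u = 0) : B.IsInvertible := by
  have hinj : Function.Injective (B : E →ₗ[ℝ] E →L[ℝ] ℝ) :=
    (injective_iff_map_eq_zero _).2 fun u hu ↦ hB u (DFunLike.congr_fun hu)
  have hdim : Module.finrank ℝ E = Module.finrank ℝ (E →L[ℝ] ℝ) := by
    rw [← (LinearMap.toContinuousLinearMap (𝕜 := ℝ) (E := E) (F' := ℝ)).finrank_eq]
    exact (Subspace.dual_finrank_eq (K := ℝ)).symm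
  exact ⟨(LinearEquiv.ofInjectiveOfFinrankEq _ hinj hdim).toContinuousLinearEquiv, rfl⟩

end MetricInChart

section GradientInChart

theorem fderiv_fderiv_eq_add {E : Type*} [NormedAddCommGroup E] [NormedSpace ℝ E]
    {G : E → E →L[ℝ] E →L[ℝ] ℝ} {V : E → E} {φ : E → ℝ} {y : E} (hG : DifferentiableAt ℝ G y)
    (hV : DifferentiableAt ℝ V y) (hGV : ∀ᶠ z in nhds y, ∀ w, G z (V z) w = fderiv ℝ φ z w)
    (u w : E) :
    fderiv ℝ (fderiv ℝ φ) y u w = G y (fderiv ℝ V y u) w + fderiv ℝ G y u (V y) w := by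
  have hφ : fderiv ℝ φ =ᶠ[nhds y] fun z ↦ G z (V z) :=
    hGV.mono fun z hz ↦ ContinuousLinearMap.ext fun w ↦ (hz w).symm
  rw [hφ.fderiv_eq, (hG.hasFDerivAt.clm_apply hV.hasFDerivAt).fderiv]
  simp

/-- This is `∇_V V = ½ ∇(G(V, V))` for the gradient `V` of `φ` with respect to `G`, with the index
lowered: the Christoffel terms are the last two on the left. -/
theorem covariantDeriv_gradient_self {E : Type*} [NormedAddCommGroup E] [NormedSpace ℝ E]
    {G : E → E →L[ℝ] E →L[ℝ] ℝ} {V : E → E} {φ : E → ℝ} {y : E} (hG : DifferentiableAt ℝ G y)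
    (hV : DifferentiableAt ℝ V y) (hφ : ContDiffAt ℝ 2 φ y) (hsymm : ∀ u v, G y u v = G y v u)
    (hGV : ∀ᶠ z in nhds y, ∀ w, G z (V z) w = fderiv ℝ φ z w) (w : E) :
    G y (fderiv ℝ V y (V y)) w + (fderiv ℝ G y (V y) (V y) w - 1 / 2 * fderiv ℝ G y w (V y) (V y))
      = 1 / 2 * fderiv ℝ (fun z ↦ G z (V z) (V z)) y w := by
  have hnorm : fderiv ℝ (fun z ↦ G z (V z) (V z)) y w
      = 2 * G y (fderiv ℝ V y w) (V y) + fderiv ℝ G y w (V y) (V y) := by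
    rw [((hG.hasFDerivAt.clm_apply hV.hasFDerivAt).clm_apply hV.hasFDerivAt).fderiv]
    simp only [ContinuousLinearMap.flip_add, add_apply, ContinuousLinearMap.comp_apply,
      ContinuousLinearMap.flip_apply, hsymm (V y)]
    ring
  have hhessian : fderiv ℝ (fderiv ℝ φ) y (V y) w = fderiv ℝ (fderiv ℝ φ) y w (V y) :=
    (hφ.isSymmSndFDerivAt (by simp)).eq (V y) w
  rw [fderiv_fderiv_eq_add hG hV hGV, fderiv_fderiv_eq_add hG hV hGV] at hhessian
  linarith

variable {E : Type*} [NormedAddCommGroup E] [NormedSpace ℝ E]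
  {M : Type*} [TopologicalSpace M] [ChartedSpace E M] {e : OpenPartialHomeomorph M E} {f : M → ℝ}

theorem contDiffOn_comp_symm {n : WithTop ℕ∞} (hf : ContMDiff 𝓘(ℝ, E) 𝓘(ℝ, ℝ) n f)
    (he : e ∈ IsManifold.maximalAtlas 𝓘(ℝ, E) n M) : ContDiffOn ℝ n (f ∘ e.symm) e.target :=
  contMDiffOn_iff_contDiffOn.1 (hf.comp_contMDiffOn (contMDiffOn_symm_of_mem_maximalAtlas he))

variable [FiniteDimensional ℝ E] [IsManifold 𝓘(ℝ, E) ∞ M]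

/-- The gradient `∇f` in the coordinates of a chart `e`, as a vector field on `e.target`. -/
noncomputable def gradientInChart (g : LorentzMetric E M) (f : M → ℝ)
    (e : OpenPartialHomeomorph M E) (y : E) : E :=
  mfderiv 𝓘(ℝ, E) 𝓘(ℝ, E) e (e.symm y) (gradient g f (e.symm y))

theorem metricInChart_gradientInChart (g : LorentzMetric E M)
    (he : e.MDifferentiable 𝓘(ℝ, E) 𝓘(ℝ, E)) {y : E} (hy : y ∈ e.target)
    (hf : MDifferentiableAt 𝓘(ℝ, E) 𝓘(ℝ, ℝ) f (e.symm y)) (w : E) :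
    metricInChart g e y (gradientInChart g f e y) w = fderiv ℝ (f ∘ e.symm) y w := by
  rw [metricInChart_apply, gradientInChart, mfderiv_symm_mfderiv he hy, inner_gradient,
    ← mfderiv_eq_fderiv]
  exact (DFunLike.congr_fun (mfderiv_comp y hf (he.mdifferentiableAt_symm hy)) w).symm

theorem metricInChart_gradientInChart_self (g : LorentzMetric E M) (f : M → ℝ)
    (he : e.MDifferentiable 𝓘(ℝ, E) 𝓘(ℝ, E)) {y : E} (hy : y ∈ e.target) :
    metricInChart g e y (gradientInChart g f e y) (gradientInChart g f e y)
      = g.inner (e.symm y) (gradient g f (e.symm y)) (gradient g f (e.symm y)) := by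
  rw [metricInChart_apply, gradientInChart, mfderiv_symm_mfderiv he hy]

theorem contDiffOn_gradientInChart (g : LorentzMetric E M) {n : WithTop ℕ∞}
    (hf : ContMDiff 𝓘(ℝ, E) 𝓘(ℝ, ℝ) (n + 1) f) (hn : n + 1 ≤ ∞)
    (he : e ∈ IsManifold.maximalAtlas 𝓘(ℝ, E) ∞ M) :
    ContDiffOn ℝ n (gradientInChart g f e) e.target := by
  have : CompleteSpace E := FiniteDimensional.complete ℝ E
  have hn' : n ≤ ∞ := le_self_add.trans hn
  have hediff := mdifferentiable_of_mem_maximalAtlas (by simp) he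
  have hG (y : E) (hy : y ∈ e.target) : (metricInChart g e y).IsInvertible :=
    isInvertible_of_nondegenerate fun u ↦ metricInChart_nondegenerate g hediff hy
  have hdf : ContDiffOn ℝ n (fderiv ℝ (f ∘ e.symm)) e.target :=
    (contDiffOn_comp_symm hf (IsManifold.maximalAtlas_subset_of_le hn he)).fderiv_of_isOpen
      e.open_target le_rfl
  have hsolve : ContDiffOn ℝ n
      (fun y ↦ (metricInChart g e y).inverse (fderiv ℝ (f ∘ e.symm) y)) e.target :=
    ContDiffOn.clm_apply (fun y hy ↦ (hG y hy).contDiffAt_map_inverse.comp_contDiffWithinAt y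
      ((contDiffOn_metricInChart g he y hy).of_le hn')) hdf
  refine hsolve.congr fun y hy ↦ ?_
  have hsharp : metricInChart g e y (gradientInChart g f e y) = fderiv ℝ (f ∘ e.symm) y :=
    ContinuousLinearMap.ext (metricInChart_gradientInChart g hediff hy
      (hf.mdifferentiable (by simp) _))
  rw [← hsharp, (hG y hy).inverse_apply_self]

theorem covariantDeriv_gradientInChart_self_eq_zero (g : LorentzMetric E M)
    (hf : ContMDiff 𝓘(ℝ, E) 𝓘(ℝ, ℝ) 2 f) (he : e ∈ IsManifold.maximalAtlas 𝓘(ℝ, E) ∞ M) {y : E}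
    (hy : y ∈ e.target)
    (hextr : IsLocalExtr (fun x ↦ g.inner x (gradient g f x) (gradient g f x)) (e.symm y)) (w : E) :
    metricInChart g e y (fderiv ℝ (gradientInChart g f e) y (gradientInChart g f e y)) w
      + christoffel g e y (gradientInChart g f e y) (gradientInChart g f e y) w = 0 := by
  have htwo : (2 : WithTop ℕ∞) ≤ ∞ := WithTop.coe_le_coe.2 (le_top (a := 2))
  have htarget : e.target ∈ nhds y := e.open_target.mem_nhds hy
  have hediff := mdifferentiable_of_mem_maximalAtlas (by simp) he
  have hnorm : (fun z ↦ metricInChart g e z (gradientInChart g f e z) (gradientInChart g f e z))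
      =ᶠ[nhds y] (fun x ↦ g.inner x (gradient g f x) (gradient g f x)) ∘ e.symm :=
    Filter.eventually_of_mem htarget fun z ↦ metricInChart_gradientInChart_self g f hediff
  have hcritical : fderiv ℝ
      (fun z ↦ metricInChart g e z (gradientInChart g f e z) (gradientInChart g f e z)) y = 0 := by
    rw [hnorm.fderiv_eq]
    exact IsLocalExtr.fderiv_eq_zero (hextr.comp_tendsto (e.continuousAt_symm hy).tendsto)
  have hidentity := covariantDeriv_gradient_self
    (((contDiffOn_metricInChart g he).contDiffAt htarget).differentiableAt (by simp))
    (((contDiffOn_gradientInChart g (n := 1) hf htwo he).contDiffAt htarget).differentiableAt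
      one_ne_zero)
    ((contDiffOn_comp_symm hf (IsManifold.maximalAtlas_subset_of_le htwo he)).contDiffAt
      htarget)
    (metricInChart_symm g e y)
    (Filter.eventually_of_mem htarget fun z hz ↦ metricInChart_gradientInChart g hediff hz
      (hf.mdifferentiable two_ne_zero _)) w
  rw [hcritical, zero_apply, mul_zero] at hidentity
  rw [← hidentity, christoffel]
  ring

theorem gradient_neg (g : LorentzMetric E M) (f : M → ℝ) (x : M) :
    gradient g (-f) x = -gradient g f x := by
  have hdf : mfderiv 𝓘(ℝ, E) 𝓘(ℝ, ℝ) (-f) x = -mfderiv 𝓘(ℝ, E) 𝓘(ℝ, ℝ) f x := mfderiv_neg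
  rw [← sub_eq_zero]
  refine g.nondegenerate x _ fun w ↦ ?_
  rw [map_sub, sub_apply, map_neg, neg_apply, inner_gradient, inner_gradient, hdf]
  exact sub_self _

end GradientInChart

section GradientCurves

theorem contDiffWithinAt_add_one_of_hasDerivWithinAt {E : Type*} [NormedAddCommGroup E]
    [NormedSpace ℝ E] {V : E → E} {c : ℝ → E} {s : Set ℝ} {t : ℝ} (ht : t ∈ s) (n : ℕ)
    (hV : ContDiffAt ℝ n V (c t)) (hc : ∀ r ∈ s, HasDerivWithinAt c (V (c r)) s r) :
    ContDiffWithinAt ℝ (n + 1) c s t := by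
  have hsucc (k : ℕ) (hVk : ContDiffAt ℝ k V (c t)) (hck : ContDiffWithinAt ℝ k c s t) :
      ContDiffWithinAt ℝ (k + 1) c s t :=
    (contDiffWithinAt_succ_iff_hasFDerivWithinAt (by simp)).2
      ⟨s, by rw [insert_eq_of_mem ht]; exact self_mem_nhdsWithin, by simp,
        fun r ↦ .toSpanSingleton ℝ (V (c r)), fun r hr ↦ (hc r hr).hasFDerivWithinAt,
        (ContinuousLinearMap.toSpanSingletonCLE (𝕜 := ℝ) (E := E)).contDiff.comp_contDiffWithinAt
          (hVk.comp_contDiffWithinAt t hck)⟩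
  induction n with
  | zero =>
    exact hsucc 0 hV ((contDiffWithinAt_zero ht).2 ⟨s, self_mem_nhdsWithin,
      fun r hr ↦ (hc r hr.1).continuousWithinAt.mono inter_subset_left⟩)
  | succ n ih => exact hsucc (n + 1) hV (ih (hV.of_le (by simp)))

variable {E : Type*} [NormedAddCommGroup E] [NormedSpace ℝ E]
  {M : Type*} [TopologicalSpace M] [ChartedSpace E M] {X : ∀ x : M, TangentSpace 𝓘(ℝ, E) x}

theorem inter_preimage_source_mem_nhdsWithin {σ : ℝ → M} {s : Set ℝ}
    {e : OpenPartialHomeomorph M E} (hσ : IsMIntegralCurveOn (I := 𝓘(ℝ, E)) σ X s) {t : ℝ}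
    (ht : t ∈ s) (hte : σ t ∈ e.source) : s ∩ σ ⁻¹' e.source ∈ nhdsWithin t s :=
  Filter.inter_mem self_mem_nhdsWithin
    ((hσ t ht).continuousWithinAt (e.open_source.mem_nhds hte))

theorem velocity_eq_of_isMIntegralCurveOn {σ : ℝ → M} {s : Set ℝ}
    (hs : UniqueDiffOn ℝ s) (hσ : IsMIntegralCurveOn (I := 𝓘(ℝ, E)) σ X s) {t : ℝ} (ht : t ∈ s) :
    velocity (E := E) σ s t = X (σ t) := by
  rw [velocity, (hσ t ht).mfderivWithin (hs t ht).uniqueMDiffWithinAt]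
  exact one_smul ℝ (X (σ t))

variable [FiniteDimensional ℝ E] [IsManifold 𝓘(ℝ, E) ∞ M]
  {g : LorentzMetric E M} {e : OpenPartialHomeomorph M E} {f : M → ℝ} {σ : ℝ → M} {s : Set ℝ}

theorem hasDerivWithinAt_chart_comp (he : e.MDifferentiable 𝓘(ℝ, E) 𝓘(ℝ, E))
    (hσ : IsMIntegralCurveOn (I := 𝓘(ℝ, E)) σ (gradient g f) s) {r : ℝ} (hr : r ∈ s)
    (hre : σ r ∈ e.source) :
    HasDerivWithinAt (e ∘ σ) (gradientInChart g f e (e (σ r))) s r := by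
  have hderiv := hasDerivWithinAt_of_hasMFDerivWithinAt
    ((he.mdifferentiableAt hre).hasMFDerivAt.comp_hasMFDerivWithinAt r (hσ r hr))
  have hgrad : gradientInChart g f e (e (σ r))
      = mfderiv 𝓘(ℝ, E) 𝓘(ℝ, E) e (σ r) (gradient g f (σ r)) :=
    congrArg (fun x ↦ (mfderiv 𝓘(ℝ, E) 𝓘(ℝ, E) e x (gradient g f x) : E)) (e.left_inv hre)
  have hone : mfderiv 𝓘(ℝ, E) 𝓘(ℝ, E) e (σ r) ((1 : ℝ) • gradient g f (σ r))
      = gradientInChart g f e (e (σ r)) := by rw [hgrad, one_smul]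
  rw [← hone]
  exact hderiv

theorem contMDiffOn_of_isMIntegralCurveOn_gradient {n : ℕ}
    (hf : ContMDiff 𝓘(ℝ, E) 𝓘(ℝ, ℝ) (n + 1) f)
    (hσ : IsMIntegralCurveOn (I := 𝓘(ℝ, E)) σ (gradient g f) s) :
    ContMDiffOn 𝓘(ℝ, ℝ) 𝓘(ℝ, E) (n + 1) σ s := by
  intro t ht
  set e := chartAt E (σ t)
  have he : e ∈ IsManifold.maximalAtlas 𝓘(ℝ, E) ∞ M := IsManifold.chart_mem_maximalAtlas _
  have hte : σ t ∈ e.source := mem_chart_source E (σ t)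
  have hn : (n + 1 : WithTop ℕ∞) ≤ ∞ := WithTop.coe_le_coe.2 (le_top (a := (n + 1 : ℕ∞)))
  have hV : ContDiffAt ℝ n (gradientInChart g f e) (e (σ t)) :=
    (contDiffOn_gradientInChart g hf hn he).contDiffAt (e.open_target.mem_nhds (e.map_source hte))
  have hchart : ContDiffWithinAt ℝ (n + 1) (e ∘ σ) (s ∩ σ ⁻¹' e.source) t :=
    contDiffWithinAt_add_one_of_hasDerivWithinAt (s := s ∩ σ ⁻¹' e.source) ⟨ht, hte⟩ n hV fun r hr ↦
      (hasDerivWithinAt_chart_comp (mdifferentiable_of_mem_maximalAtlas (by simp) he) hσ hr.1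
        hr.2).mono inter_subset_left
  exact contMDiffWithinAt_iff_target.2 ⟨(hσ t ht).continuousWithinAt,
    contMDiffWithinAt_iff_contDiffWithinAt.2
      (hchart.mono_of_mem_nhdsWithin (inter_preimage_source_mem_nhdsWithin hσ ht hte))⟩

theorem isGeodesicOn_of_isMIntegralCurveOn_gradient (hs : UniqueDiffOn ℝ s)
    (hf : ContMDiff 𝓘(ℝ, E) 𝓘(ℝ, ℝ) 2 f)
    (hσ : IsMIntegralCurveOn (I := 𝓘(ℝ, E)) σ (gradient g f) s)
    (hextr : ∀ t ∈ s, IsLocalExtr (fun x ↦ g.inner x (gradient g f x) (gradient g f x)) (σ t)) :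
    IsGeodesicOn g σ s := by
  refine ⟨contMDiffOn_of_isMIntegralCurveOn_gradient (n := 1) hf hσ, ?_⟩
  intro e he t ht hte w c
  have htarget : c t ∈ e.target := e.map_source hte
  have hc (r : ℝ) (hr : r ∈ s ∩ σ ⁻¹' e.source) :
      HasDerivWithinAt c (gradientInChart g f e (c r)) s r :=
    hasDerivWithinAt_chart_comp (mdifferentiable_of_mem_maximalAtlas (by simp) he) hσ hr.1 hr.2
  have hc' (r : ℝ) (hr : r ∈ s ∩ σ ⁻¹' e.source) :
      derivWithin c s r = gradientInChart g f e (c r) := (hc r hr).derivWithin (hs r hr.1)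
  have hV : DifferentiableAt ℝ (gradientInChart g f e) (c t) :=
    ((contDiffOn_gradientInChart g (n := 1) hf (WithTop.coe_le_coe.2 (le_top (a := 2)))
      he).contDiffAt (e.open_target.mem_nhds htarget)).differentiableAt one_ne_zero
  have hc'' : derivWithin (derivWithin c s) s t
      = fderiv ℝ (gradientInChart g f e) (c t) (gradientInChart g f e (c t)) :=
    ((hV.hasFDerivAt.comp_hasDerivWithinAt t (hc t ⟨ht, hte⟩)).congr_of_eventuallyEq
      (Filter.eventually_of_mem (inter_preimage_source_mem_nhdsWithin hσ ht hte) hc')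
      (hc' t ⟨ht, hte⟩)).derivWithin (hs t ht)
  rw [hc'', hc' t ⟨ht, hte⟩]
  refine covariantDeriv_gradientInChart_self_eq_zero g hf he htarget ?_ w
  rw [show e.symm (c t) = σ t from e.left_inv hte]
  exact hextr t ht

theorem hasDerivWithinAt_comp_curve {r : ℝ} (hf : MDifferentiableAt 𝓘(ℝ, E) 𝓘(ℝ, ℝ) f (σ r))
    (hσ : MDifferentiableWithinAt 𝓘(ℝ, ℝ) 𝓘(ℝ, E) σ s r) :
    HasDerivWithinAt (f ∘ σ)
      (g.inner (σ r) (gradient g f (σ r)) (velocity σ s r)) s r := by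
  rw [inner_gradient]
  exact hasDerivWithinAt_of_hasMFDerivWithinAt
    (hf.hasMFDerivAt.comp_hasMFDerivWithinAt r hσ.hasMFDerivWithinAt)

theorem eqOn_const_of_deriv_nonpos {φ φ' : ℝ → ℝ} {a b : ℝ}
    (hderiv : ∀ t ∈ Icc a b, HasDerivWithinAt φ (φ' t) (Icc a b) t)
    (hφ' : ∀ t ∈ Icc a b, φ' t ≤ 0) (hle : φ a ≤ φ b) : ∀ t ∈ Icc a b, φ t = φ a := by
  have hanti : AntitoneOn φ (Icc a b) :=
    antitoneOn_of_hasDerivWithinAt_nonpos (convex_Icc a b)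
      (fun t ht ↦ (hderiv t ht).continuousWithinAt)
      (fun t ht ↦ (hderiv t (interior_subset ht)).mono interior_subset)
      fun t ht ↦ hφ' t (interior_subset ht)
  intro t ht
  have hab : a ≤ b := ht.1.trans ht.2
  exact le_antisymm (hanti (left_mem_Icc.2 hab) ht ht.1)
    (hle.trans (hanti ht (right_mem_Icc.2 hab) ht.2))

theorem deriv_eq_zero_of_deriv_nonpos {φ φ' : ℝ → ℝ} {a b : ℝ} (hab : a < b)
    (hderiv : ∀ t ∈ Icc a b, HasDerivWithinAt φ (φ' t) (Icc a b) t)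
    (hφ' : ∀ t ∈ Icc a b, φ' t ≤ 0) (hle : φ a ≤ φ b) : ∀ t ∈ Icc a b, φ' t = 0 := by
  have hconst := eqOn_const_of_deriv_nonpos hderiv hφ' hle
  exact fun t ht ↦ (uniqueDiffOn_Icc hab t ht).eq_deriv _ (hderiv t ht)
    ((hasDerivWithinAt_const t (Icc a b) (φ a)).congr hconst (hconst t ht))

theorem isNullGeodesicOn_of_isMIntegralCurveOn_gradient {a b : ℝ} (hab : a < b)
    (hf : ContMDiff 𝓘(ℝ, E) 𝓘(ℝ, ℝ) 2 f) (hcausal : ∀ x, IsCausalVector g (gradient g f x))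
    (hσ : IsMIntegralCurveOn (I := 𝓘(ℝ, E)) σ (gradient g f) (Icc a b))
    (hle : f (σ a) ≤ f (σ b)) :
    IsNullGeodesicOn g σ (Icc a b) ∧ ∀ t ∈ Icc a b, f (σ t) = f (σ a) := by
  have huniq := uniqueDiffOn_Icc hab
  have hderiv (t : ℝ) (ht : t ∈ Icc a b) : HasDerivWithinAt (f ∘ σ)
      (g.inner (σ t) (gradient g f (σ t)) (gradient g f (σ t))) (Icc a b) t := by
    rw [← congrArg (g.inner (σ t) (gradient g f (σ t)))
      (velocity_eq_of_isMIntegralCurveOn huniq hσ ht)]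
    exact hasDerivWithinAt_comp_curve (hf.mdifferentiable two_ne_zero _)
      (hσ t ht).mdifferentiableWithinAt
  have hnonpos (x : M) : g.inner x (gradient g f x) (gradient g f x) ≤ 0 :=
    (hcausal x).inner_self_nonpos
  have hnull := deriv_eq_zero_of_deriv_nonpos hab hderiv (fun t _ ↦ hnonpos (σ t)) hle
  refine ⟨⟨isGeodesicOn_of_isMIntegralCurveOn_gradient huniq hf hσ fun t ht ↦ .inr ?_,
    fun t ht ↦ ?_⟩, eqOn_const_of_deriv_nonpos hderiv (fun t _ ↦ hnonpos (σ t)) hle⟩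
  · exact Filter.Eventually.of_forall fun x ↦ (hnonpos x).trans_eq (hnull t ht).symm
  · rw [velocity_eq_of_isMIntegralCurveOn huniq hσ ht]
    exact ⟨(hcausal _).ne_zero, hnull t ht⟩

end GradientCurves

section Reparametrization

theorem exists_orderIso_of_le_deriv {S S' : ℝ → ℝ} {m : ℝ} (hm : 0 < m)
    (hS : ∀ t, HasDerivAt S (S' t) t) (hS' : ∀ t, m ≤ S' t) :
    ∃ o : ℝ ≃o ℝ, ⇑o = S ∧ ∀ s, HasDerivAt o.symm (S' (o.symm s))⁻¹ s := by
  have hpos (t : ℝ) : 0 < S' t := hm.trans_le (hS' t)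
  have hgrow (x y : ℝ) (hxy : x ≤ y) : m * (y - x) ≤ S y - S x :=
    mul_sub_le_image_sub_of_le_deriv (fun t ↦ (hS t).differentiableAt)
      (fun t ↦ by rw [(hS t).deriv]; exact hS' t) hxy
  have hsurj : Function.Surjective S := fun y ↦ by
    set R := |y - S 0| / m
    have hR : 0 ≤ R := div_nonneg (abs_nonneg _) hm.le
    have hmR : m * R = |y - S 0| := mul_div_cancel₀ _ hm.ne'
    exact mem_range_of_exists_le_of_exists_ge
      (continuous_iff_continuousAt.2 fun t ↦ (hS t).continuousAt)
      ⟨-R, by linarith [hgrow (-R) 0 (by linarith), neg_abs_le (y - S 0)]⟩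
      ⟨R, by linarith [hgrow 0 R hR, le_abs_self (y - S 0)]⟩
  let o := (strictMono_of_hasDerivAt_pos hS hpos).orderIsoOfSurjective S hsurj
  exact ⟨o, rfl, fun s ↦ HasDerivAt.of_local_left_inverse o.symm.continuous.continuousAt (hS _)
    (hpos _).ne' (Filter.Eventually.of_forall o.apply_symm_apply)⟩

theorem exists_reparametrization {p q : ℝ} (hpq : p < q) {ρ : ℝ → ℝ}
    (hρ : ContinuousOn ρ (Icc p q)) (hpos : ∀ t ∈ Icc p q, 0 < ρ t) :
    ∃ B > 0, ∃ τ : ℝ → ℝ, τ 0 = p ∧ τ B = q ∧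
      ∀ s ∈ Icc 0 B, τ s ∈ Icc p q ∧ HasDerivAt τ (ρ (τ s))⁻¹ s := by
  obtain ⟨t₀, ht₀, hmin⟩ := isCompact_Icc.exists_isMinOn (nonempty_Icc.2 hpq.le) hρ
  set μ : ℝ → ℝ := IccExtend hpq.le ((Icc p q).domRestrict ρ)
  have hμ : Continuous μ := (continuousOn_iff_continuous_domRestrict.1 hρ).Icc_extend'
  have hderiv (t : ℝ) : HasDerivAt (fun t ↦ ∫ x in p..t, μ x) (μ t) t :=
    intervalIntegral.integral_hasDerivAt_right (hμ.intervalIntegrable _ _)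
      (hμ.stronglyMeasurableAtFilter _ _) hμ.continuousAt
  obtain ⟨S, hS, hτ⟩ := exists_orderIso_of_le_deriv (hpos t₀ ht₀) hderiv
    fun t ↦ hmin (projIcc p q hpq.le t).2
  have hSp : S p = 0 := by
    rw [hS]
    exact intervalIntegral.integral_same
  refine ⟨S q, hSp ▸ S.strictMono hpq, S.symm, S.symm_apply_eq.2 hSp.symm, S.symm_apply_apply q,
    fun s hs ↦ ?_⟩
  have hmem : S.symm s ∈ Icc p q := by
    rwa [mem_Icc, S.le_symm_apply, S.symm_apply_le, hSp]
  have hμρ : μ (S.symm s) = ρ (S.symm s) := IccExtend_of_mem hpq.le _ hmem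
  exact ⟨hmem, hμρ ▸ hτ s⟩

end Reparametrization

section FlowReachability

variable {E : Type*} [NormedAddCommGroup E] [NormedSpace ℝ E]
  {H : Type*} [TopologicalSpace H] {I : ModelWithCorners ℝ E H}
  {M : Type*} [TopologicalSpace M] [ChartedSpace H M]
  {X : ∀ x : M, TangentSpace I x}

theorem isMIntegralCurveOn_congr {σ τ : ℝ → M} {s : Set ℝ} (hτ : IsMIntegralCurveOn τ X s)
    (h : EqOn σ τ s) : IsMIntegralCurveOn σ X s := by
  intro r hr
  refine ((hτ r hr).congr_of_eventuallyEq (Filter.eventually_of_mem self_mem_nhdsWithin h)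
    (h hr)).congr_mfderiv ?_
  exact congrArg (fun x ↦ ((1 : ℝ →L[ℝ] ℝ).smulRight (X x) : ℝ →L[ℝ] E)) (h hr).symm

theorem isMIntegralCurveOn_union {σ : ℝ → M} {s t : Set ℝ} (hs : IsClosed s) (ht : IsClosed t)
    (hσs : IsMIntegralCurveOn σ X s) (hσt : IsMIntegralCurveOn σ X t) :
    IsMIntegralCurveOn σ X (s ∪ t) := by
  have hnhds {u v : Set ℝ} {r : ℝ} (hv : IsClosed v) (hr : r ∉ v) : u ∈ nhdsWithin r (u ∪ v) := by
    filter_upwards [self_mem_nhdsWithin, mem_nhdsWithin_of_mem_nhds (hv.isOpen_compl.mem_nhds hr)]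
      with x hx hxv using hx.resolve_right hxv
  intro r hr
  by_cases hrs : r ∈ s <;> by_cases hrt : r ∈ t
  · exact (hσs r hrs).union (hσt r hrt)
  · exact (hσs r hrs).mono_of_mem_nhdsWithin (hnhds ht hrt)
  · exact (hσt r hrt).mono_of_mem_nhdsWithin (union_comm s t ▸ hnhds hs hrs)
  · exact absurd hr (not_or.2 ⟨hrs, hrt⟩)

/-- `y` is reachable from `x` by following the vector field `X` for a positive time. The integral
curve is only required to exist on the closed time interval, with one-sided derivatives at its end
points. -/
def IsFlowReachable (X : ∀ x : M, TangentSpace I x) (x y : M) : Prop :=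
  ∃ B > 0, ∃ σ : ℝ → M, σ 0 = x ∧ σ B = y ∧ IsMIntegralCurveOn σ X (Icc 0 B)

theorem IsFlowReachable.trans {x y z : M} (hxy : IsFlowReachable X x y)
    (hyz : IsFlowReachable X y z) : IsFlowReachable X x z := by
  obtain ⟨B, hB, σ, hσ0, hσB, hσ⟩ := hxy
  obtain ⟨C, hC, τ, hτ0, hτC, hτ⟩ := hyz
  have hshift : IsMIntegralCurveOn (τ ∘ (· + -B)) X (Icc B (B + C)) :=
    (hτ.comp_add (-B)).mono fun t ht ↦ ⟨by linarith [ht.1], by linarith [ht.2]⟩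
  set κ : ℝ → M := (Iic B).piecewise σ (τ ∘ (· + -B))
  have hκσ : EqOn κ σ (Icc 0 B) := fun t ht ↦ piecewise_eq_of_mem _ _ _ ht.2
  have hκτ : EqOn κ (τ ∘ (· + -B)) (Icc B (B + C)) := fun t ht ↦ by
    rcases ht.1.eq_or_lt with rfl | hlt
    · rw [hκσ ⟨hB.le, le_rfl⟩, hσB, Function.comp_apply, add_neg_cancel, hτ0]
    · exact piecewise_eq_of_notMem _ _ _ hlt.not_ge
  refine ⟨B + C, add_pos hB hC, κ, (hκσ ⟨le_rfl, hB.le⟩).trans hσ0, ?_, ?_⟩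
  · rw [hκτ ⟨by linarith, le_rfl⟩, Function.comp_apply, add_neg_cancel_comm, hτC]
  · rw [← Icc_union_Icc_eq_Icc hB.le (by linarith : B ≤ B + C)]
    exact isMIntegralCurveOn_union isClosed_Icc isClosed_Icc (isMIntegralCurveOn_congr hσ hκσ)
      (isMIntegralCurveOn_congr hshift hκτ)

theorem isFlowReachable_of_mfderivWithin_eq_smul {γ : ℝ → M} {p q : ℝ} (hpq : p < q) {ρ : ℝ → ℝ}
    (hρ : ContinuousOn ρ (Icc p q)) (hpos : ∀ t ∈ Icc p q, 0 < ρ t)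
    (hγ : MDifferentiableOn 𝓘(ℝ, ℝ) I γ (Icc p q))
    (hvel : ∀ t ∈ Icc p q, mfderivWithin 𝓘(ℝ, ℝ) I γ (Icc p q) t (1 : ℝ) = ρ t • X (γ t)) :
    IsFlowReachable X (γ p) (γ q) := by
  obtain ⟨B, hB, τ, hτ0, hτB, hτ⟩ := exists_reparametrization hpq hρ hpos
  refine ⟨B, hB, γ ∘ τ, congrArg γ hτ0, congrArg γ hτB, fun s hs ↦ ?_⟩
  obtain ⟨hmem, hderiv⟩ := hτ s hs
  have hchain := (hγ (τ s) hmem).hasMFDerivWithinAt.comp s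
    (hasMFDerivWithinAt_iff_hasFDerivWithinAt.2 hderiv.hasDerivWithinAt.hasFDerivWithinAt)
    fun r hr ↦ (hτ r hr).1
  refine hchain.congr_mfderiv (ContinuousLinearMap.ext_ring ?_)
  let D : ℝ →L[ℝ] E := mfderivWithin 𝓘(ℝ, ℝ) I γ (Icc p q) (τ s)
  let v : E := X (γ (τ s))
  have hD : D 1 = ρ (τ s) • v := hvel (τ s) hmem
  change D ((1 : ℝ) • (ρ (τ s))⁻¹) = (1 : ℝ) • v
  rw [smul_eq_mul, mul_comm, ← smul_eq_mul, map_smul, hD, inv_smul_smul₀ (hpos _ hmem).ne',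
    one_smul]

end FlowReachability

section Causality

variable {E : Type*} [NormedAddCommGroup E] [NormedSpace ℝ E]
  {M : Type*} [TopologicalSpace M] [ChartedSpace E M] [IsManifold 𝓘(ℝ, E) ∞ M]
  {g : LorentzMetric E M} {T : TimeOrientation g} {γ : ℝ → M} {p q : ℝ}

theorem continuousOn_velocity (hpq : p < q) (hγ : ContMDiffOn 𝓘(ℝ, ℝ) 𝓘(ℝ, E) 1 γ (Icc p q)) :
    ContinuousOn (fun t ↦ (⟨γ t, velocity γ (Icc p q) t⟩ : TangentBundle 𝓘(ℝ, E) M))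
      (Icc p q) := by
  have hone : Continuous (fun t : ℝ ↦ (⟨t, (1 : ℝ)⟩ : TangentBundle 𝓘(ℝ, ℝ) ℝ)) :=
    (contMDiff_vectorSpace_iff_contDiff (n := 0).2 contDiff_const).continuous
  exact (hγ.continuousOn_tangentMapWithin le_rfl (uniqueDiffOn_Icc hpq).uniqueMDiffOn).comp
    hone.continuousOn fun t ht ↦ ht

theorem TimeOrientation.continuousOn_inner_velocity (T : TimeOrientation g) (hpq : p < q)
    (hγ : ContMDiffOn 𝓘(ℝ, ℝ) 𝓘(ℝ, E) 1 γ (Icc p q)) :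
    ContinuousOn (fun t ↦ g.inner (γ t) (T.field (γ t)) (velocity γ (Icc p q) t))
      (Icc p q) := by
  have hT := contMDiffOn_zero_iff (I := 𝓘(ℝ, ℝ)) (I' := 𝓘(ℝ, E).tangent).2
    (T.continuous_field.comp_continuousOn hγ.continuousOn)
  have hvel := contMDiffOn_zero_iff (I := 𝓘(ℝ, ℝ)) (I' := 𝓘(ℝ, E).tangent).2
    (continuousOn_velocity hpq hγ)
  exact fun t ht ↦ (g.contMDiffWithinAt_inner (by simp) (hT t ht) (hvel t ht)).continuousWithinAt

variable [FiniteDimensional ℝ E] {h : M → ℝ}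

theorem TimeOrientation.continuous_inner_gradient (T : TimeOrientation g)
    (hh : ContMDiff 𝓘(ℝ, E) 𝓘(ℝ, ℝ) 1 h) :
    Continuous fun x ↦ g.inner x (T.field x) (gradient g h x) := by
  have htangent := (tangentBundleModelSpaceHomeomorph 𝓘(ℝ, ℝ)).continuous.comp
    ((hh.continuous_tangentMap le_rfl).comp T.continuous_field)
  refine (continuous_snd.comp htangent).congr fun x ↦ ?_
  rw [g.symm, inner_gradient]
  simp only [Function.comp_apply, tangentBundleModelSpaceHomeomorph_coe]
  rfl

theorem antitoneOn_comp_of_futureCausal (hh : MDifferentiable 𝓘(ℝ, E) 𝓘(ℝ, ℝ) h)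
    (hfut : ∀ x, T.FutureCausal (gradient g h x))
    (hγ : MDifferentiableOn 𝓘(ℝ, ℝ) 𝓘(ℝ, E) γ (Icc p q))
    (hvel : ∀ r ∈ Icc p q, T.FutureCausal (velocity γ (Icc p q) r)) :
    AntitoneOn (h ∘ γ) (Icc p q) := by
  have hderiv (r : ℝ) (hr : r ∈ Icc p q) :=
    hasDerivWithinAt_comp_curve (g := g) (hh (γ r)) (hγ r hr)
  exact antitoneOn_of_hasDerivWithinAt_nonpos (convex_Icc p q)
    (fun r hr ↦ (hderiv r hr).continuousWithinAt)
    (fun r hr ↦ (hderiv r (interior_subset hr)).mono interior_subset)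
    fun r hr ↦ (hfut _).inner_nonpos (hvel r (interior_subset hr))

theorem isFlowReachable_gradient_of_futureCausal (hh : ContMDiff 𝓘(ℝ, E) 𝓘(ℝ, ℝ) 1 h)
    (hfut : ∀ x, T.FutureCausal (gradient g h x)) (hpq : p < q)
    (hγ : ContMDiffOn 𝓘(ℝ, ℝ) 𝓘(ℝ, E) 1 γ (Icc p q))
    (hvel : ∀ r ∈ Icc p q, T.FutureCausal (velocity γ (Icc p q) r)) (hle : h (γ p) ≤ h (γ q)) :
    IsFlowReachable (gradient g h) (γ p) (γ q) := by
  have hdiff : MDifferentiableOn 𝓘(ℝ, ℝ) 𝓘(ℝ, E) γ (Icc p q) :=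
    hγ.mdifferentiableOn one_ne_zero
  have hzero : ∀ r ∈ Icc p q, g.inner (γ r) (gradient g h (γ r)) (velocity γ (Icc p q) r) = 0 :=
    fun r hr ↦ deriv_eq_zero_of_deriv_nonpos hpq
      (fun r hr ↦ hasDerivWithinAt_comp_curve (hh.mdifferentiable one_ne_zero (γ r)) (hdiff r hr))
      (fun r hr ↦ (hfut _).inner_nonpos (hvel r hr)) hle r hr
  exact isFlowReachable_of_mfderivWithin_eq_smul hpq
    ((T.continuousOn_inner_velocity hpq hγ).div
      ((T.continuous_inner_gradient hh).comp_continuousOn hγ.continuousOn)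
      fun r _ ↦ (hfut (γ r)).2.ne)
    (fun r hr ↦ div_pos_of_neg_of_neg (hvel r hr).2 (hfut (γ r)).2) hdiff
    fun r hr ↦ (hfut (γ r)).eq_smul_of_inner_nonneg (hvel r hr) (hzero r hr).ge

theorem IsFutureCausalCurve.isFlowReachable_gradient {a b : ℝ} (hγ : IsFutureCausalCurve T γ a b)
    (hab : a < b) (hh : ContMDiff 𝓘(ℝ, E) 𝓘(ℝ, ℝ) 1 h)
    (hfut : ∀ x, T.FutureCausal (gradient g h x)) (hle : h (γ a) ≤ h (γ b)) :
    IsFlowReachable (gradient g h) (γ a) (γ b) := by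
  obtain ⟨n, t, rfl, rfl, hpieces⟩ := hγ
  have hn : 0 < n := Nat.pos_of_ne_zero fun h0 ↦ hab.ne (by rw [h0])
  have hanti : AntitoneOn (fun i ↦ h (γ (t i))) (Iic n) :=
    antitoneOn_of_succ_le ordConnected_Iic fun i _ _ hi ↦ by
      obtain ⟨hlt, hC, hvel⟩ := hpieces i (Nat.lt_of_succ_le hi)
      exact antitoneOn_comp_of_futureCausal (hh.mdifferentiable one_ne_zero) hfut
        (hC.mdifferentiableOn one_ne_zero) hvel (left_mem_Icc.2 hlt.le) (right_mem_Icc.2 hlt.le)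
        hlt.le
  have hstep : ∀ i < n, IsFlowReachable (gradient g h) (γ (t i)) (γ (t (i + 1))) := fun i hi ↦ by
    obtain ⟨hlt, hC, hvel⟩ := hpieces i hi
    refine isFlowReachable_gradient_of_futureCausal hh hfut hlt hC hvel ?_
    calc h (γ (t i)) ≤ h (γ (t 0)) := hanti (Nat.zero_le n) hi.le (Nat.zero_le i)
      _ ≤ h (γ (t n)) := hle
      _ ≤ h (γ (t (i + 1))) := hanti hi (le_refl n) hi
  suffices ∀ k, 1 ≤ k → k ≤ n → IsFlowReachable (gradient g h) (γ (t 0)) (γ (t k)) from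
    this n hn le_rfl
  intro k hk
  induction k, hk using Nat.le_induction with
  | base => exact fun _ ↦ hstep 0 hn
  | succ k _ ih => exact fun hkn ↦ (ih (by lia)).trans (hstep k hkn)

end Causality

end QuasiTime

theorem proposition4p8_general {E : Type*} [NormedAddCommGroup E] [NormedSpace ℝ E]
    [FiniteDimensional ℝ E] {M : Type*} [TopologicalSpace M] [ChartedSpace E M]
    [IsManifold 𝓘(ℝ, E) ∞ M] {g : QuasiTime.LorentzMetric E M} (T : QuasiTime.TimeOrientation g)
    {f : M → ℝ} (hf : ContMDiff 𝓘(ℝ, E) 𝓘(ℝ, ℝ) 2 f)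
    (hpast : ∀ x, T.PastCausal (QuasiTime.gradient g f x))
    (hgeo : ∀ (γ : ℝ → M) (a b : ℝ), a < b → QuasiTime.IsNullGeodesicOn g γ (Icc a b) →
      (∃ k : ℝ, ∀ t ∈ Icc a b, f (γ t) = k) → γ a ≠ γ b) :
    QuasiTime.IsCausal T := by
  have hfut (x : M) : T.FutureCausal (QuasiTime.gradient g (-f) x) := by
    rw [QuasiTime.gradient_neg]
    exact (hpast x).neg
  rintro ⟨γ, a, b, hab, hγ, hclosed⟩
  obtain ⟨B, hB, σ, hσ0, hσB, hσ⟩ : QuasiTime.IsFlowReachable (QuasiTime.gradient g (-f)) _ _ :=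
    hγ.isFlowReachable_gradient hab (hf.neg.of_le one_le_two) hfut (congrArg (-f) hclosed).le
  have hloop : σ 0 = σ B := hσ0.trans (hclosed.trans hσB.symm)
  obtain ⟨hnull, hconst⟩ := QuasiTime.isNullGeodesicOn_of_isMIntegralCurveOn_gradient hB hf.neg
    (fun x ↦ (hfut x).1) hσ (congrArg (-f) hloop).le
  exact hgeo σ 0 B hB hnull ⟨f (σ 0), fun t ht ↦ neg_injective (hconst t ht)⟩ hloop

/-- Any spacetime (time-oriented smooth Lorentzian manifold) that admits a quasi-time function is
causal. -/
theorem proposition4p8 {E : Type*} [NormedAddCommGroup E] [NormedSpace ℝ E] [FiniteDimensional ℝ E]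
    {M : Type*} [TopologicalSpace M] [T2Space M] [SecondCountableTopology M]
    [ChartedSpace E M] [IsManifold 𝓘(ℝ, E) ∞ M]
    (g : QuasiTime.LorentzMetric E M) (T : QuasiTime.TimeOrientation g)
    (h : ∃ f : M → ℝ, QuasiTime.IsQuasiTimeFunction T f) :
    QuasiTime.IsCausal T := by
  obtain ⟨f, hf⟩ := h
  exact proposition4p8_general T (hf.smooth.of_le (WithTop.coe_le_coe.2 (le_top (a := 2))))
    hf.gradient_pastCausal fun γ a b hab hγ hk heq ↦ hab.ne <|
      hf.injOn_of_isNullGeodesicOn γ a b hab hγ hk (left_mem_Icc.2 hab.le) (right_mem_Icc.2 hab.le)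
        heq
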